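/- Let $\Pi=\{s\in\mathbb{C}:\operatorname{Re}s>0\}$ and $U_1=\{z\in\mathbb{C}:|z|<1\}$. For a nonempty bounded domain $G\subset\mathbb{C}$ with convex hull $\widetilde G$, the isometric Bohr abscissa $\mathbf{b}(G)$ is the infimum of those real $\sigma\ge 0$ with the following property: for every bounded holomorphic function $f$ on $\Pi$ with $f(\Pi)\subset G$ that is the sum of a Dirichlet series $f(s)=\sum_{n=1}^{\infty}a_n n^{-s}$ converging at each point of $\Pi$, one has $$\sum_{n=2}^{\infty}\frac{|a_n|}{n^{\sigma}}<\operatorname{dist}(a_1,\partial\widetilde G).$$ If $G\subset\mathbb{C}$ is a nonempty bounded convex domain, then $\mathbf{b}(G)$ does not depend on the choice of $G$: the sets of such $\sigma$ for $G$ and for $U_1$ are nonempty (so both abscissas are finite non-negative real numbers), and $\mathbf{b}(G)=\mathbf{b}(U_1)$. -/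

import Mathlib

open Filter Topology

/-- The right half-plane `Π = {s : Re s > 0}`. -/
def rightHalfPlane : Set ℂ := {s : ℂ | 0 < s.re}

/-- `f` is a bounded holomorphic function on the right half-plane that is the sum there of the
ordinary Dirichlet series `∑_{n ≥ 1} a n / n ^ s`. Convergence is that of the partial sums and need
not be absolute; the value `a 0` plays no role. -/
structure IsBoundedDirichletSeries (f : ℂ → ℂ) (a : ℕ → ℂ) : Prop where
  differentiableOn : DifferentiableOn ℂ f rightHalfPlane
  bounded : ∃ C : ℝ, ∀ s ∈ rightHalfPlane, ‖f s‖ ≤ C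
  converges : ∀ s ∈ rightHalfPlane,
    Tendsto (fun N : ℕ => ∑ n ∈ Finset.Icc 1 N, a n / (n : ℂ) ^ s) atTop (𝓝 (f s))

/-- The set of those `σ ≥ 0` such that for every bounded Dirichlet series `f = ∑ a n / n ^ s` on the
right half-plane with values in `G`, the series `∑_{n ≥ 2} |a n| / n ^ σ` converges and its sum is
less than the distance from `a 1` to the boundary of the convex hull of `G`. -/
def bohrAdmissible (G : Set ℂ) : Set ℝ :=
  {σ : ℝ | 0 ≤ σ ∧ ∀ (f : ℂ → ℂ) (a : ℕ → ℂ), IsBoundedDirichletSeries f a →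
    Set.MapsTo f rightHalfPlane G →
      Summable (fun n : ℕ => ‖a (n + 2)‖ / ((n + 2 : ℕ) : ℝ) ^ σ) ∧
      ∑' n : ℕ, ‖a (n + 2)‖ / ((n + 2 : ℕ) : ℝ) ^ σ
        < Metric.infDist (a 1) (frontier (convexHull ℝ G))}

/-- The isometric Bohr abscissa of `G`: the infimum of the admissible `σ` (a set of reals bounded
below by `0`; the infimum is meaningful when that set is nonempty). -/
noncomputable def isometricBohrAbscissa (G : Set ℂ) : ℝ := sInf (bohrAdmissible G)

/-!
For convex `G` the convex hull is `G` itself. The two abscissas are compared through half-planes and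
discs.

* An admissible `σ` for `G` is admissible for the unit disc: take a disc contained in `G` that
  touches the boundary of `G` at a point `p`. A function `f` into the unit disc, rotated so that its
  constant coefficient points towards `p` and rescaled, maps into `G`, and the distance of its
  constant coefficient to the boundary is at most the radius times `1 - |a₁|`
  (`bohrAdmissible_subset_bohrAdmissible_ball`).
* If `σ` is admissible for the unit disc, then every `τ > σ` is admissible for `G`: a half-plane
  containing `G` and supporting it at the boundary point `p` closest to `a₁` reduces the claim to
  functions with positive real part, and these are limits of functions into large discs
  (`tsum_le_re_of_re_pos`). The limit costs strictness of the inequality, which passing from `σ` to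
  `τ` restores (`mem_bohrAdmissible_of_lt`).

Hence the infima agree. That some exponent is admissible for the unit disc comes from
Carathéodory's inequality `|aₙ| n ^ (-2) ≤ 2 Re a₁` for Dirichlet series with non-negative real part
(`IsBoundedDirichletSeries.norm_coeff_le_of_re_nonneg`), applied to `1 - u f`. It follows from the
positivity of the mean value of `Re f (2 + it) * (1 + Re (w * n ^ (it)))` with `|w| ≤ 1`. The same
inequality shows that `a₁` lies in `G` (`IsBoundedDirichletSeries.coeff_one_mem`).
-/

/-! ### Mean values of absolutely convergent exponential sums -/

theorem tendsto_mean_exp (c : ℝ) :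
    Tendsto (fun T : ℝ => (T : ℂ)⁻¹ * ∫ t in (0 : ℝ)..T, Complex.exp ((c * Complex.I) * t)) atTop
      (𝓝 (if c = 0 then 1 else 0)) := by
  split_ifs with hc
  · refine tendsto_const_nhds.congr' ?_
    filter_upwards [eventually_gt_atTop (0 : ℝ)] with T hT
    have : (T : ℂ) ≠ 0 := by exact_mod_cast hT.ne'
    simp [hc, this]
  · have hc' : (c : ℂ) * Complex.I ≠ 0 := mul_ne_zero (by exact_mod_cast hc) Complex.I_ne_zero
    have hz : Tendsto (fun T : ℝ => T⁻¹ * (2 / |c|)) atTop (𝓝 0) := by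
      simpa using tendsto_inv_atTop_zero.mul_const (2 / |c|)
    refine squeeze_zero_norm' ?_ hz
    filter_upwards [eventually_gt_atTop (0 : ℝ)] with T hT
    rw [integral_exp_mul_complex hc', norm_mul, norm_inv, Complex.norm_real, Real.norm_eq_abs,
      abs_of_pos hT, norm_div]
    have h1 : ‖(c : ℂ) * Complex.I‖ = |c| := by simp
    rw [h1]
    gcongr
    refine (norm_sub_le _ _).trans (le_of_eq ?_)
    have h2 : (c : ℂ) * Complex.I * T = ((c * T : ℝ) : ℂ) * Complex.I := by push_cast; ring
    rw [h2, Complex.norm_exp_ofReal_mul_I]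
    norm_num

theorem norm_exp_mul_I_mul (c t : ℝ) : ‖Complex.exp ((c * Complex.I) * t)‖ = 1 := by
  have : (c : ℂ) * Complex.I * t = ((c * t : ℝ) : ℂ) * Complex.I := by push_cast; ring
  rw [this, Complex.norm_exp_ofReal_mul_I]

theorem continuous_tsum_exp {b : ℕ → ℂ} (hb : Summable fun n => ‖b n‖) (ℓ : ℕ → ℝ) :
    Continuous fun t : ℝ => ∑' n, b n * Complex.exp ((ℓ n * Complex.I) * t) :=
  continuous_tsum (fun n => by fun_prop) hb fun n t => by simp [norm_exp_mul_I_mul]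

/-- The mean value of an absolutely convergent exponential sum collects the coefficients of
frequency zero. -/
theorem tendsto_mean_tsum_exp {b : ℕ → ℂ} (hb : Summable fun n => ‖b n‖) (ℓ : ℕ → ℝ) :
    Tendsto (fun T : ℝ => (T : ℂ)⁻¹ *
        ∫ t in (0 : ℝ)..T, ∑' n, b n * Complex.exp ((ℓ n * Complex.I) * t)) atTop
      (𝓝 (∑' n, b n * if ℓ n = 0 then 1 else 0)) := by
  have key : ∀ T : ℝ, 0 < T → (T : ℂ)⁻¹ *
      ∫ t in (0 : ℝ)..T, ∑' n, b n * Complex.exp ((ℓ n * Complex.I) * t) =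
      ∑' n, b n * ((T : ℂ)⁻¹ * ∫ t in (0 : ℝ)..T, Complex.exp ((ℓ n * Complex.I) * t)) := by
    intro T hT
    have h := intervalIntegral.hasSum_integral_of_dominated_convergence
      (μ := MeasureTheory.volume) (a := 0) (b := T)
      (F := fun n (t : ℝ) => b n * Complex.exp ((ℓ n * Complex.I) * t))
      (f := fun t : ℝ => ∑' n, b n * Complex.exp ((ℓ n * Complex.I) * t))
      (fun n _ => ‖b n‖)
      (fun n => by
        apply Continuous.aestronglyMeasurable
        fun_prop)
      (fun n => by simp [norm_exp_mul_I_mul])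
      (by simp [hb])
      (by simp)
      (by
        refine Eventually.of_forall fun t _ => Summable.hasSum ?_
        exact Summable.of_norm (by simpa [norm_exp_mul_I_mul] using hb))
    rw [← h.tsum_eq, ← tsum_mul_left]
    refine tsum_congr fun n => ?_
    rw [intervalIntegral.integral_const_mul]
    ring
  refine Tendsto.congr' ((eventually_gt_atTop 0).mono fun T hT => (key T hT).symm) ?_
  refine tendsto_tsum_of_dominated_convergence hb
    (fun n => (tendsto_mean_exp (ℓ n)).const_mul (b n)) ?_
  filter_upwards [eventually_gt_atTop (0 : ℝ)] with T hT n
  rw [norm_mul]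
  refine mul_le_of_le_one_right (norm_nonneg _) ?_
  have h := intervalIntegral.norm_integral_le_of_norm_le_const (a := 0) (b := T) (C := 1)
    (f := fun t : ℝ => Complex.exp ((ℓ n * Complex.I) * t))
    (fun t _ => (norm_exp_mul_I_mul _ _).le)
  rw [norm_mul, norm_inv, Complex.norm_real, Real.norm_eq_abs, abs_of_pos hT]
  rw [sub_zero, abs_of_pos hT, one_mul] at h
  exact (inv_mul_le_one₀ hT).2 h

/-- The mean value against `exp (i c t)` collects the coefficients of frequency `-c`. -/
theorem tendsto_mean_tsum_exp_mul {b : ℕ → ℂ} (hb : Summable fun n => ‖b n‖) (ℓ : ℕ → ℝ) (c : ℝ) :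
    Tendsto (fun T : ℝ => (T : ℂ)⁻¹ *
        ∫ t in (0 : ℝ)..T, (∑' n, b n * Complex.exp ((ℓ n * Complex.I) * t)) *
          Complex.exp ((c * Complex.I) * t)) atTop
      (𝓝 (∑' n, b n * if ℓ n + c = 0 then 1 else 0)) := by
  refine (tendsto_mean_tsum_exp hb fun n => ℓ n + c).congr fun T => ?_
  congr 2
  ext t
  rw [← tsum_mul_right]
  refine tsum_congr fun n => ?_
  rw [mul_assoc (b n), ← Complex.exp_add, ← add_mul, ← add_mul, Complex.ofReal_add]

/-- Carathéodory's coefficient inequality for exponential sums with non-positive frequencies. The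
mean of the non-negative function `Re h * (1 + Re (w * exp (-i ℓ m t)))`, with `|w| ≤ 1`, is
`Re (b 0 + w * b m / 2)`, because `h` has no component of the positive frequency `-ℓ m`. -/
theorem norm_coeff_le_two_mul_re {b : ℕ → ℂ} (hb : Summable fun n => ‖b n‖) {ℓ : ℕ → ℝ}
    (hℓ : StrictAnti ℓ) (hℓ0 : ℓ 0 = 0)
    (hre : ∀ t : ℝ, 0 ≤ (∑' n, b n * Complex.exp ((ℓ n * Complex.I) * t)).re)
    {m : ℕ} (hm : m ≠ 0) : ‖b m‖ ≤ 2 * (b 0).re := by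
  set h : ℝ → ℂ := fun t => ∑' n, b n * Complex.exp ((ℓ n * Complex.I) * t)
  have hcont : Continuous h := continuous_tsum_exp hb ℓ
  have hneg : ℓ m < 0 := hℓ0 ▸ hℓ (Nat.pos_of_ne_zero hm)
  -- the choice of `w` that makes the lower bound from the mean as strong as possible
  obtain ⟨w, hw, hwb⟩ : ∃ w : ℂ, ‖w‖ ≤ 1 ∧ (w * b m).re = -‖b m‖ := by
    by_cases h0 : b m = 0
    · exact ⟨0, by simp [h0]⟩
    · have hn : (‖b m‖ : ℂ) ≠ 0 := by simpa using h0
      refine ⟨-(starRingEnd ℂ (b m) / ‖b m‖), ?_, ?_⟩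
      · simp [div_self (norm_ne_zero_iff.2 h0)]
      · have : -(starRingEnd ℂ (b m) / ‖b m‖) * b m = ((-‖b m‖ : ℝ) : ℂ) := by
          field_simp
          rw [Complex.conj_mul']
          push_cast
          ring
        rw [this, Complex.ofReal_re]
  -- the three means that enter the mean of `h * (1 + Re (w * exp (-i ℓ m t)))`
  have l0 := tendsto_mean_tsum_exp hb ℓ
  have l1 := (tendsto_mean_tsum_exp_mul hb ℓ (-ℓ m)).const_mul (w / 2)
  have l2 := (tendsto_mean_tsum_exp_mul hb ℓ (ℓ m)).const_mul (starRingEnd ℂ w / 2)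
  have e0 : (∑' n, b n * if ℓ n = 0 then (1 : ℂ) else 0) = b 0 := by
    rw [tsum_eq_single 0]
    · simp [hℓ0]
    · intro n hn
      rw [if_neg, mul_zero]
      rw [← hℓ0]
      exact hℓ.injective.ne hn
  have e1 : (∑' n, b n * if ℓ n + -ℓ m = 0 then (1 : ℂ) else 0) = b m := by
    rw [tsum_eq_single m]
    · simp
    · intro n hn
      rw [if_neg, mul_zero]
      rw [← sub_eq_add_neg, sub_eq_zero]
      exact hℓ.injective.ne hn
  have e2 : (∑' n, b n * if ℓ n + ℓ m = 0 then (1 : ℂ) else 0) = 0 := by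
    refine (tsum_congr fun n => ?_).trans tsum_zero
    have : ℓ n ≤ 0 := hℓ0 ▸ hℓ.antitone (Nat.zero_le n)
    rw [if_neg (by linarith), mul_zero]
  rw [e0] at l0
  rw [e1] at l1
  rw [e2] at l2
  have l := (Complex.continuous_re.tendsto _).comp ((l0.add l1).add l2)
  have hlim : 0 ≤ (b 0 + w / 2 * b m + starRingEnd ℂ w / 2 * 0).re := by
    refine ge_of_tendsto l ?_
    filter_upwards [eventually_gt_atTop (0 : ℝ)] with T hT
    have hI : ∀ c : ℝ, IntervalIntegrable (fun t : ℝ => h t * Complex.exp ((c * Complex.I) * t))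
        MeasureTheory.volume 0 T := fun c =>
      Continuous.intervalIntegrable (by fun_prop) _ _
    have hsum : (T : ℂ)⁻¹ * (∫ t in (0 : ℝ)..T, h t) +
        w / 2 * ((T : ℂ)⁻¹ * ∫ t in (0 : ℝ)..T, h t * Complex.exp (((-ℓ m : ℝ) * Complex.I) * t)) +
        starRingEnd ℂ w / 2 *
          ((T : ℂ)⁻¹ * ∫ t in (0 : ℝ)..T, h t * Complex.exp ((ℓ m * Complex.I) * t)) =
        (T⁻¹ : ℝ) * ∫ t in (0 : ℝ)..T,
          h t * ((1 + (w * Complex.exp (((-ℓ m : ℝ) * Complex.I) * t)).re : ℝ) : ℂ) := by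
      have hpt : ∀ t : ℝ,
          h t * ((1 + (w * Complex.exp (((-ℓ m : ℝ) * Complex.I) * t)).re : ℝ) : ℂ) =
          h t + w / 2 * (h t * Complex.exp (((-ℓ m : ℝ) * Complex.I) * t)) +
            starRingEnd ℂ w / 2 * (h t * Complex.exp ((ℓ m * Complex.I) * t)) := by
        intro t
        have hc : starRingEnd ℂ (Complex.exp (((-ℓ m : ℝ) * Complex.I) * t)) =
            Complex.exp ((ℓ m * Complex.I) * t) := by
          rw [← Complex.exp_conj]
          simp
        push_cast
        rw [Complex.re_eq_add_conj, map_mul]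
        push_cast at hc
        rw [hc]
        ring
      simp_rw [hpt]
      rw [intervalIntegral.integral_add, intervalIntegral.integral_add,
        intervalIntegral.integral_const_mul, intervalIntegral.integral_const_mul]
      · push_cast
        ring
      · exact hcont.intervalIntegrable _ _
      · exact (hI _).const_mul _
      · exact (hcont.intervalIntegrable _ _).add ((hI _).const_mul _)
      · exact (hI _).const_mul _
    have hre_int : 0 ≤ (∫ t in (0 : ℝ)..T,
        h t * ((1 + (w * Complex.exp (((-ℓ m : ℝ) * Complex.I) * t)).re : ℝ) : ℂ)).re := by
      have hii : IntervalIntegrable (fun t : ℝ =>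
          h t * ((1 + (w * Complex.exp (((-ℓ m : ℝ) * Complex.I) * t)).re : ℝ) : ℂ))
          MeasureTheory.volume 0 T := by
        apply Continuous.intervalIntegrable
        have : Continuous fun t : ℝ => (w * Complex.exp (((-ℓ m : ℝ) * Complex.I) * t)).re :=
          Complex.continuous_re.comp (by fun_prop)
        fun_prop
      have := Complex.reCLM.intervalIntegral_comp_comm hii
      rw [Complex.reCLM_apply] at this
      rw [← this]
      refine intervalIntegral.integral_nonneg hT.le fun t _ => ?_
      rw [Complex.reCLM_apply, Complex.re_mul_ofReal]
      refine mul_nonneg (hre t) ?_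
      have h1 := Complex.abs_re_le_norm (w * Complex.exp (((-ℓ m : ℝ) * Complex.I) * t))
      rw [norm_mul, norm_exp_mul_I_mul, mul_one] at h1
      linarith [(abs_le.1 (h1.trans hw)).1]
    have hsum_re := congrArg Complex.re hsum
    rw [Complex.re_ofReal_mul] at hsum_re
    exact (mul_nonneg (inv_nonneg.2 hT.le) hre_int).trans_eq hsum_re.symm
  have hw2 : (w / 2 * b m).re = -‖b m‖ / 2 := by
    rw [div_mul_eq_mul_div, show (2 : ℂ) = ((2 : ℝ) : ℂ) by norm_num, Complex.div_ofReal_re, hwb]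
  rw [mul_zero, add_zero, Complex.add_re, hw2] at hlim
  linarith

/-! ### Coefficients of bounded Dirichlet series -/

namespace IsBoundedDirichletSeries

variable {f : ℂ → ℂ} {a : ℕ → ℂ}

theorem const_mul_add_const (hf : IsBoundedDirichletSeries f a) (α β : ℂ) :
    IsBoundedDirichletSeries (fun s => α * f s + β)
      (fun n => α * a n + if n = 1 then β else 0) where
  differentiableOn := (hf.differentiableOn.const_mul α).add_const β
  bounded := by
    obtain ⟨C, hC⟩ := hf.bounded
    refine ⟨‖α‖ * C + ‖β‖, fun s hs => (norm_add_le _ _).trans ?_⟩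
    rw [norm_mul]
    gcongr
    exact hC s hs
  converges s hs := by
    refine (((hf.converges s hs).const_mul α).add_const β).congr' ?_
    filter_upwards [eventually_ge_atTop 1] with N hN
    have h1 : ∑ n ∈ Finset.Icc 1 N, (if n = 1 then β else 0) / (n : ℂ) ^ s = β := by
      rw [Finset.sum_eq_single 1]
      · simp
      · intro n _ hn
        simp [hn]
      · simp [hN]
    simp_rw [add_div, Finset.sum_add_distrib, h1, Finset.mul_sum, mul_div_assoc]

theorem summable_norm_div_sq (hf : IsBoundedDirichletSeries f a) :
    Summable fun n : ℕ => ‖a (n + 1) / ((n : ℂ) + 1) ^ 2‖ := by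
  -- the terms of the series at `s = 1 / 2` tend to zero, so they are bounded
  have hs : (1 / 2 : ℂ) ∈ rightHalfPlane := by
    simp [rightHalfPlane]
  have hc := hf.converges _ hs
  have hz : Tendsto (fun n : ℕ => a (n + 1) / ((n + 1 : ℕ) : ℂ) ^ (1 / 2 : ℂ)) atTop (𝓝 0) := by
    have := ((tendsto_add_atTop_iff_nat 1).2 hc).sub hc
    rw [sub_self] at this
    refine this.congr fun n => ?_
    rw [Finset.sum_Icc_succ_top (by omega)]
    ring
  obtain ⟨C, hC⟩ := (Metric.isBounded_range_of_tendsto _ hz).exists_norm_le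
  have hbase : Summable fun n : ℕ => C * (1 / ((n + 1 : ℕ) : ℝ) ^ (3 / 2 : ℝ)) :=
    ((summable_nat_add_iff 1).2
      (Real.summable_one_div_nat_rpow.2 (by norm_num : (1 : ℝ) < 3 / 2))).mul_left C
  refine Summable.of_nonneg_of_le (fun _ => norm_nonneg _) (fun n => ?_) hbase
  have hpos : (0 : ℝ) < ((n + 1 : ℕ) : ℝ) := by positivity
  have h1 := hC _ ⟨n, rfl⟩
  rw [norm_div, Complex.norm_natCast_cpow_of_pos n.succ_pos] at h1
  rw [show ((1 / 2 : ℂ)).re = 1 / 2 by norm_num] at h1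
  rw [norm_div, norm_pow]
  have h2 : ‖(n : ℂ) + 1‖ = ((n + 1 : ℕ) : ℝ) := by
    rw [← Nat.cast_succ, Complex.norm_natCast]
  rw [h2]
  have h3 : ((n + 1 : ℕ) : ℝ) ^ 2 =
      ((n + 1 : ℕ) : ℝ) ^ (1 / 2 : ℝ) * ((n + 1 : ℕ) : ℝ) ^ (3 / 2 : ℝ) := by
    rw [← Real.rpow_add hpos, ← Real.rpow_natCast]
    norm_num
  rw [h3, ← div_div, div_eq_mul_one_div (_ / _)]
  gcongr

theorem eq_tsum_exp (hf : IsBoundedDirichletSeries f a) (t : ℝ) :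
    ∑' n : ℕ, a (n + 1) / ((n : ℂ) + 1) ^ 2 *
      Complex.exp (((-Real.log (n + 1) : ℝ) * Complex.I) * t) = f (2 + t * Complex.I) := by
  have hs : (2 + t * Complex.I) ∈ rightHalfPlane := by simp [rightHalfPlane]
  refine HasSum.tsum_eq ?_
  have hsm : Summable fun n : ℕ => a (n + 1) / ((n : ℂ) + 1) ^ 2 *
      Complex.exp (((-Real.log (n + 1) : ℝ) * Complex.I) * t) := by
    refine Summable.of_norm ?_
    simpa only [norm_mul, norm_exp_mul_I_mul, mul_one] using hf.summable_norm_div_sq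
  refine (hsm.hasSum_iff_tendsto_nat).2 ((hf.converges _ hs).congr fun N => ?_)
  rw [← Finset.Ico_add_one_right_eq_Icc, Finset.sum_Ico_eq_sum_range]
  refine Finset.sum_congr rfl fun n _ => ?_
  have h0 : (n : ℂ) + 1 ≠ 0 := by exact_mod_cast n.succ_ne_zero
  have hlog : Complex.log ((n : ℂ) + 1) = ((Real.log (n + 1) : ℝ) : ℂ) := by
    rw [Complex.ofReal_log (by positivity)]
    push_cast
    rfl
  rw [add_comm 1 n, Nat.cast_succ, Complex.cpow_add _ _ h0, Complex.cpow_ofNat,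
    Complex.cpow_def_of_ne_zero h0 (_ * _), hlog, div_mul_eq_div_mul_one_div,
    one_div (Complex.exp _), ← Complex.exp_neg]
  congr 2
  push_cast
  ring

/-- Carathéodory's coefficient inequality for Dirichlet series with non-negative real part. The
mean values are taken on the line `Re s = 2`, where the series converges absolutely. -/
theorem norm_coeff_le_of_re_nonneg (hf : IsBoundedDirichletSeries f a)
    (hre : ∀ s ∈ rightHalfPlane, 0 ≤ (f s).re) (n : ℕ) :
    ‖a (n + 2)‖ ≤ 2 * (a 1).re * ((n : ℝ) + 2) ^ 2 := by
  have hanti : StrictAnti fun n : ℕ => -Real.log ((n : ℝ) + 1) := by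
    intro m n hmn
    have : (m : ℝ) < n := by exact_mod_cast hmn
    exact neg_lt_neg (Real.log_lt_log (by positivity) (by linarith))
  have h := norm_coeff_le_two_mul_re hf.summable_norm_div_sq hanti (by simp)
    (fun t => by
      rw [hf.eq_tsum_exp t]
      exact hre _ (by simp [rightHalfPlane])) n.succ_ne_zero
  have hn : ‖((n + 1 : ℕ) : ℂ) + 1‖ = (n : ℝ) + 2 := by
    rw [← Nat.cast_succ, Complex.norm_natCast]
    push_cast
    ring
  rw [norm_div, norm_pow, hn, div_le_iff₀ (by positivity)] at h
  simpa using h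

theorem re_coeff_one_pos (hf : IsBoundedDirichletSeries f a)
    (hre : ∀ s ∈ rightHalfPlane, 0 < (f s).re) : 0 < (a 1).re := by
  have hle := hf.norm_coeff_le_of_re_nonneg fun s hs => (hre s hs).le
  by_contra! h
  have hz : ∀ n, a (n + 2) = 0 := fun n => by
    refine norm_le_zero_iff.1 ((hle n).trans ?_)
    exact mul_nonpos_of_nonpos_of_nonneg (by linarith) (by positivity)
  -- then `f` is the constant `a 1`, whose real part is not positive
  have hs : (2 + (0 : ℝ) * Complex.I) ∈ rightHalfPlane := by simp [rightHalfPlane]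
  have h2 := hf.eq_tsum_exp 0
  rw [tsum_eq_single 0 fun n hn => ?_] at h2
  · have h3 := hre _ hs
    rw [← h2] at h3
    simp at h3
    linarith
  · obtain ⟨m, rfl⟩ := Nat.exists_eq_succ_of_ne_zero hn
    simp [hz m]

/-- The constant coefficient lies in every open convex set that contains the values: otherwise a
separating functional would give a Dirichlet series with positive real part and constant
coefficient zero. -/
theorem coeff_one_mem (hf : IsBoundedDirichletSeries f a) {G : Set ℂ} (hG : IsOpen G)
    (hconv : Convex ℝ G) (hfG : Set.MapsTo f rightHalfPlane G) : a 1 ∈ G := by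
  by_contra ha
  obtain ⟨φ, hφ⟩ := RCLike.geometric_hahn_banach_open_point (𝕜 := ℂ) hconv hG ha
  have happly : ∀ z, φ z = φ 1 * z := fun z => by
    have := φ.map_smul z 1
    simpa [mul_comm] using this
  have h := (hf.const_mul_add_const (-φ 1) (φ (a 1))).re_coeff_one_pos fun s hs => by
    have := hφ _ (hfG hs)
    rw [happly (f s)] at this
    simp only [RCLike.re_to_complex, neg_mul, Complex.add_re, Complex.neg_re] at this ⊢
    linarith
  rw [happly (a 1)] at h
  simp at h

end IsBoundedDirichletSeries

/-! ### Admissible exponents -/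

theorem one_sub_norm_le_infDist_frontier_ball (z : ℂ) :
    1 - ‖z‖ ≤ Metric.infDist z (frontier (Metric.ball (0 : ℂ) 1)) := by
  rw [frontier_ball _ one_ne_zero, Metric.le_infDist (NormedSpace.sphere_nonempty.2 zero_le_one)]
  intro y hy
  rw [mem_sphere_zero_iff_norm] at hy
  rw [dist_comm, dist_eq_norm, ← hy]
  exact norm_sub_norm_le y z

theorem tsum_one_div_add_two_sq_lt_one :
    Summable (fun n : ℕ => 1 / ((n + 2 : ℕ) : ℝ) ^ 2) ∧
      ∑' n : ℕ, 1 / ((n + 2 : ℕ) : ℝ) ^ 2 < 1 := by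
  have h := (hasSum_nat_add_iff' 2).2 hasSum_zeta_two
  refine ⟨h.summable, ?_⟩
  rw [h.tsum_eq]
  have := Real.pi_lt_d2
  have := Real.pi_pos
  norm_num [Finset.sum_range_succ]
  nlinarith

theorem exists_norm_eq_one_mul_eq_norm (z : ℂ) : ∃ u : ℂ, ‖u‖ = 1 ∧ u * z = ‖z‖ := by
  by_cases hz : z = 0
  · exact ⟨1, by simp [hz]⟩
  · have hn : (‖z‖ : ℂ) ≠ 0 := by simpa using hz
    refine ⟨starRingEnd ℂ z / ‖z‖, ?_, ?_⟩
    · simp [div_self (norm_ne_zero_iff.2 hz)]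
    · field_simp
      rw [Complex.conj_mul']

/-- If `f` maps into the unit disc then `1 - u f`, with `u a₁ = |a₁|`, has positive real part, so
that `|aₙ| ≤ 2 (1 - |a₁|) n ^ 2`; the exponent `6` leaves the factor `2 ∑_{n ≥ 2} n ^ (-4) < 1`. -/
theorem six_mem_bohrAdmissible_ball : (6 : ℝ) ∈ bohrAdmissible (Metric.ball (0 : ℂ) 1) := by
  refine ⟨by norm_num, fun f a hf hmaps => ?_⟩
  rw [(convex_ball (0 : ℂ) 1).convexHull_eq]
  have ha : ‖a 1‖ < 1 := by
    simpa using hf.coeff_one_mem Metric.isOpen_ball (convex_ball (0 : ℂ) 1) hmaps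
  obtain ⟨u, hu, hua⟩ := exists_norm_eq_one_mul_eq_norm (a 1)
  have hre : ∀ s ∈ rightHalfPlane, 0 ≤ (-u * f s + 1).re := fun s hs => by
    have h1 : ‖f s‖ < 1 := by simpa using hmaps hs
    have h2 := Complex.re_le_norm (u * f s)
    rw [norm_mul, hu, one_mul] at h2
    rw [neg_mul, Complex.add_re, Complex.neg_re, Complex.one_re]
    linarith
  have hcoeff : ∀ n, ‖a (n + 2)‖ ≤ 2 * (1 - ‖a 1‖) * ((n : ℝ) + 2) ^ 2 := fun n => by
    have h := (hf.const_mul_add_const (-u) 1).norm_coeff_le_of_re_nonneg hre n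
    simp only [neg_mul, hua, if_true, norm_neg, norm_mul, hu, one_mul, Complex.add_re,
      Complex.neg_re, Complex.ofReal_re, Complex.one_re, add_zero,
      if_neg (show n + 2 ≠ 1 by omega)] at h
    linarith
  obtain ⟨hS, hS1⟩ := tsum_one_div_add_two_sq_lt_one
  have hterm : ∀ n : ℕ, ‖a (n + 2)‖ / ((n + 2 : ℕ) : ℝ) ^ (6 : ℝ) ≤
      (1 - ‖a 1‖) * (1 / ((n + 2 : ℕ) : ℝ) ^ 2) := fun n => by
    have hn : (2 : ℝ) ≤ (n : ℝ) + 2 := by linarith [n.cast_nonneg (α := ℝ)]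
    have h4 : (2 : ℝ) ≤ ((n : ℝ) + 2) ^ 2 := by nlinarith
    rw [show (6 : ℝ) = ((6 : ℕ) : ℝ) by norm_num, Real.rpow_natCast]
    push_cast
    rw [mul_one_div, div_le_div_iff₀ (by positivity) (by positivity)]
    calc ‖a (n + 2)‖ * ((n : ℝ) + 2) ^ 2
        ≤ 2 * (1 - ‖a 1‖) * ((n : ℝ) + 2) ^ 2 * ((n : ℝ) + 2) ^ 2 := by
          gcongr
          exact hcoeff n
      _ ≤ ((n : ℝ) + 2) ^ 2 * (1 - ‖a 1‖) * ((n : ℝ) + 2) ^ 2 * ((n : ℝ) + 2) ^ 2 := by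
          have : 0 ≤ 1 - ‖a 1‖ := by linarith
          gcongr
      _ = (1 - ‖a 1‖) * ((n : ℝ) + 2) ^ 6 := by ring
  have hsum := Summable.of_nonneg_of_le (fun n => by positivity) hterm (hS.mul_left (1 - ‖a 1‖))
  refine ⟨hsum, lt_of_lt_of_le ?_ (one_sub_norm_le_infDist_frontier_ball (a 1))⟩
  refine (hsum.tsum_le_tsum hterm (hS.mul_left _)).trans_lt ?_
  rw [tsum_mul_left]
  exact mul_lt_of_lt_one_right (by linarith) hS1

/-- A disc inscribed in `G` and touching the complement at `p` carries any extremal function of the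
unit disc to `G`, after a rotation that turns `a₁` towards `p`. -/
theorem bohrAdmissible_subset_bohrAdmissible_ball {G : Set ℂ} (hGopen : IsOpen G)
    (hGne : G.Nonempty) (hGconv : Convex ℝ G) (hGbdd : Bornology.IsBounded G) :
    bohrAdmissible G ⊆ bohrAdmissible (Metric.ball (0 : ℂ) 1) := by
  rintro σ ⟨hσ0, hσ⟩
  refine ⟨hσ0, fun f a hf hmaps => ?_⟩
  rw [hGconv.convexHull_eq] at hσ
  rw [(convex_ball (0 : ℂ) 1).convexHull_eq]
  obtain ⟨c, hc⟩ := hGne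
  have hcne : Gᶜ.Nonempty := by
    rw [Set.nonempty_compl]
    rintro rfl
    exact NormedSpace.unbounded_univ ℝ ℂ hGbdd
  obtain ⟨p, hp, hpd⟩ := hGopen.isClosed_compl.exists_infDist_eq_dist hcne c
  have hcp : c ≠ p := fun h => hp (h ▸ hc)
  have hball : Metric.ball c (dist c p) ⊆ G := hpd ▸ Metric.ball_infDist_compl_subset
  have hr : 0 < ‖p - c‖ := norm_pos_iff.2 (sub_ne_zero.2 hcp.symm)
  have hpf : p ∈ frontier G := by
    rw [hGopen.frontier_eq]
    refine ⟨closure_mono hball ?_, hp⟩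
    rw [closure_ball _ (dist_ne_zero.2 hcp), Metric.mem_closedBall, dist_comm]
  obtain ⟨u, hu, hua⟩ := exists_norm_eq_one_mul_eq_norm (a 1)
  have hg := hf.const_mul_add_const ((p - c) * u) c
  have key := hσ _ _ hg fun s hs => hball ?_
  · have h1 : ((p - c) * u * a 1 + c) = (p - c) * ‖a 1‖ + c := by
      rw [mul_assoc, hua]
    have hterm : ∀ n : ℕ,
        ‖(p - c) * u * a (n + 2) + if n + 2 = 1 then c else 0‖ / ((n + 2 : ℕ) : ℝ) ^ σ =
          ‖p - c‖ * (‖a (n + 2)‖ / ((n + 2 : ℕ) : ℝ) ^ σ) := fun n => by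
      rw [if_neg (by omega), add_zero, norm_mul, norm_mul, hu, mul_one, mul_div_assoc]
    simp only [hterm, if_true, h1] at key
    rw [summable_mul_left_iff hr.ne', tsum_mul_left] at key
    refine ⟨key.1, lt_of_lt_of_le ?_ (one_sub_norm_le_infDist_frontier_ball (a 1))⟩
    have ha : ‖a 1‖ < 1 := by
      simpa using hf.coeff_one_mem Metric.isOpen_ball (convex_ball (0 : ℂ) 1) hmaps
    have h2 := key.2.trans_le (Metric.infDist_le_dist_of_mem hpf)
    rw [dist_comm, dist_eq_norm,
      show p - ((p - c) * ‖a 1‖ + c) = (p - c) * ((1 - ‖a 1‖ : ℝ) : ℂ) by push_cast; ring,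
      norm_mul, Complex.norm_real, Real.norm_of_nonneg (by linarith)] at h2
    exact lt_of_mul_lt_mul_left h2 hr.le
  · have h1 : ‖f s‖ < 1 := by simpa using hmaps hs
    rw [Metric.mem_ball, dist_eq_norm, add_sub_cancel_right, norm_mul, norm_mul, hu, mul_one,
      dist_comm, dist_eq_norm]
    exact mul_lt_of_lt_one_right hr h1

/-- The Bohr inequality for a half-plane, from that for the unit disc: a bounded function with
positive real part maps, after a translation by `ε`, into a large disc tangent to the imaginary
axis at `0`. -/
theorem tsum_le_re_of_re_pos {σ : ℝ} (hσ : σ ∈ bohrAdmissible (Metric.ball (0 : ℂ) 1))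
    {f : ℂ → ℂ} {a : ℕ → ℂ} (hf : IsBoundedDirichletSeries f a)
    (hre : ∀ s ∈ rightHalfPlane, 0 < (f s).re) :
    Summable (fun n : ℕ => ‖a (n + 2)‖ / ((n + 2 : ℕ) : ℝ) ^ σ) ∧
      ∑' n : ℕ, ‖a (n + 2)‖ / ((n + 2 : ℕ) : ℝ) ^ σ ≤ (a 1).re := by
  suffices H : ∀ ε : ℝ, 0 < ε → Summable (fun n : ℕ => ‖a (n + 2)‖ / ((n + 2 : ℕ) : ℝ) ^ σ) ∧
      ∑' n : ℕ, ‖a (n + 2)‖ / ((n + 2 : ℕ) : ℝ) ^ σ < (a 1).re + ε from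
    ⟨(H 1 one_pos).1, le_of_forall_pos_lt_add fun ε hε => (H ε hε).2⟩
  intro ε hε
  obtain ⟨C, hC⟩ := hf.bounded
  obtain ⟨-, hσ⟩ := hσ
  rw [(convex_ball (0 : ℂ) 1).convexHull_eq] at hσ
  set M : ℝ := |C| + |(a 1).im| + ε
  have hMpos : 0 < M := by positivity
  -- `|w| ≤ M` and `Re w > ε` imply `|w - R| < R` once `M ^ 2 ≤ 2 R ε`
  set R : ℝ := M ^ 2 / ε with hR
  have hRpos : 0 < R := by positivity
  have hRne : (R : ℂ) ≠ 0 := by exact_mod_cast hRpos.ne'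
  -- subtracting `i Im a₁` makes the constant coefficient real
  set β : ℂ := ε - (a 1).im * Complex.I with hβ
  have hg := hf.const_mul_add_const (R : ℂ)⁻¹ ((R : ℂ)⁻¹ * β - 1)
  have key := hσ _ _ hg fun s hs => ?_
  · have h1 : ((R : ℂ)⁻¹ * a 1 + ((R : ℂ)⁻¹ * β - 1)) =
        ((R⁻¹ * ((a 1).re + ε) : ℝ) : ℂ) - 1 := by
      nth_rewrite 1 [← Complex.re_add_im (a 1)]
      rw [hβ]
      push_cast
      ring
    have hterm : ∀ n : ℕ,
        ‖(R : ℂ)⁻¹ * a (n + 2) + if n + 2 = 1 then (R : ℂ)⁻¹ * β - 1 else 0‖ /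
          ((n + 2 : ℕ) : ℝ) ^ σ = R⁻¹ * (‖a (n + 2)‖ / ((n + 2 : ℕ) : ℝ) ^ σ) := fun n => by
      rw [if_neg (by omega), add_zero, norm_mul, norm_inv, Complex.norm_real,
        Real.norm_of_nonneg hRpos.le, mul_div_assoc]
    simp only [hterm, if_true, h1] at key
    rw [summable_mul_left_iff (inv_ne_zero hRpos.ne'), tsum_mul_left] at key
    refine ⟨key.1, ?_⟩
    have hmem : (-1 : ℂ) ∈ frontier (Metric.ball (0 : ℂ) 1) := by
      rw [frontier_ball _ one_ne_zero]
      simp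
    have h2 := key.2.trans_le (Metric.infDist_le_dist_of_mem hmem)
    have hpos := hf.re_coeff_one_pos hre
    rw [dist_eq_norm, sub_neg_eq_add, sub_add_cancel, Complex.norm_real,
      Real.norm_of_nonneg (by positivity)] at h2
    exact lt_of_mul_lt_mul_left h2 (inv_nonneg.2 hRpos.le)
  · have hw : (R : ℂ)⁻¹ * f s + ((R : ℂ)⁻¹ * β - 1) = (R : ℂ)⁻¹ * (f s + β - R) := by
      field_simp
      ring
    rw [mem_ball_zero_iff, hw, norm_mul, norm_inv, Complex.norm_real,
      Real.norm_of_nonneg hRpos.le, inv_mul_lt_one₀ hRpos]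
    set w : ℂ := f s + β with hw
    have hwM : ‖w‖ ≤ M := by
      have hβn : ‖β‖ ≤ |(a 1).im| + ε := by
        refine (norm_sub_le _ _).trans (le_of_eq ?_)
        rw [norm_mul, Complex.norm_I, Complex.norm_real, Complex.norm_real, Real.norm_eq_abs,
          Real.norm_eq_abs, abs_of_pos hε]
        ring
      have := norm_add_le (f s) β
      have := hC s hs
      have := le_abs_self C
      linarith
    have hwre : ε < w.re := by
      have := hre s hs
      simp [hw, hβ, this]
    have hsq : ‖w - R‖ ^ 2 = ‖w‖ ^ 2 - 2 * R * w.re + R ^ 2 := by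
      rw [Complex.sq_norm, Complex.sq_norm, Complex.normSq_apply, Complex.normSq_apply]
      simp
      ring
    have hMR : M ^ 2 = R * ε := by
      rw [hR]
      field_simp
    have hw2 : ‖w‖ ^ 2 ≤ M ^ 2 := by gcongr
    have hlt : R * ε < R * w.re := by gcongr
    have hRε : 0 < R * ε := by positivity
    refine lt_of_pow_lt_pow_left₀ 2 hRpos.le ?_
    rw [hsq]
    linarith

/-- Enlarging the exponent turns the non-strict inequality coming from the half-plane that supports
`G` at the boundary point closest to `a₁` into a strict one. -/
theorem mem_bohrAdmissible_of_lt {G : Set ℂ} (hGopen : IsOpen G) (hGne : G.Nonempty)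
    (hGconv : Convex ℝ G) (hGbdd : Bornology.IsBounded G) {σ τ : ℝ}
    (hσ : σ ∈ bohrAdmissible (Metric.ball (0 : ℂ) 1)) (hστ : σ < τ) : τ ∈ bohrAdmissible G := by
  refine ⟨hσ.1.trans hστ.le, fun f a hf hmaps => ?_⟩
  rw [hGconv.convexHull_eq]
  have hfne : (frontier G).Nonempty := by
    refine nonempty_frontier_iff.2 ⟨hGne, ?_⟩
    rintro rfl
    exact NormedSpace.unbounded_univ ℝ ℂ hGbdd
  obtain ⟨p, hp, hpd⟩ := isClosed_frontier.exists_infDist_eq_dist hfne (a 1)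
  rw [hpd]
  have hpG : p ∉ G := (hGopen.frontier_eq ▸ hp).2
  have haG := hf.coeff_one_mem hGopen hGconv hmaps
  have hd : 0 < dist (a 1) p := dist_pos.2 fun h => hpG (h ▸ haG)
  obtain ⟨φ, hφ⟩ := RCLike.geometric_hahn_banach_open_point (𝕜 := ℂ) hGconv hGopen hpG
  have happly : ∀ z, φ z = φ 1 * z := fun z => by
    have := φ.map_smul z 1
    simpa [mul_comm] using this
  have hφpos : 0 < ‖φ 1‖ := by
    refine norm_pos_iff.2 fun h0 => ?_
    have := hφ _ haG
    rw [happly, happly p, h0] at this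
    simp at this
  have hsum := tsum_le_re_of_re_pos hσ (hf.const_mul_add_const (-φ 1) (φ p)) fun s hs => by
    have := hφ _ (hmaps hs)
    rw [happly (f s)] at this
    simp only [RCLike.re_to_complex, neg_mul, Complex.add_re, Complex.neg_re] at this ⊢
    linarith
  have hterm : ∀ n : ℕ, ‖-φ 1 * a (n + 2) + if n + 2 = 1 then φ p else 0‖ /
      ((n + 2 : ℕ) : ℝ) ^ σ = ‖φ 1‖ * (‖a (n + 2)‖ / ((n + 2 : ℕ) : ℝ) ^ σ) := fun n => by
    rw [if_neg (by omega), add_zero, norm_mul, norm_neg, mul_div_assoc]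
  have h1 : -φ 1 * a 1 + φ p = φ 1 * (p - a 1) := by
    rw [happly p]
    ring
  simp only [hterm, if_true, h1] at hsum
  rw [summable_mul_left_iff hφpos.ne', tsum_mul_left] at hsum
  obtain ⟨hS, hle⟩ := hsum
  have hle' : ∑' n : ℕ, ‖a (n + 2)‖ / ((n + 2 : ℕ) : ℝ) ^ σ ≤ dist (a 1) p := by
    have := hle.trans (Complex.re_le_norm _)
    rw [norm_mul, ← dist_eq_norm, dist_comm] at this
    exact le_of_mul_le_mul_left this hφpos
  have hpow : ∀ n : ℕ, ((n + 2 : ℕ) : ℝ) ^ σ < ((n + 2 : ℕ) : ℝ) ^ τ := fun n =>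
    Real.rpow_lt_rpow_of_exponent_lt (by push_cast; linarith [n.cast_nonneg (α := ℝ)]) hστ
  have hmono : ∀ n : ℕ, ‖a (n + 2)‖ / ((n + 2 : ℕ) : ℝ) ^ τ ≤
      ‖a (n + 2)‖ / ((n + 2 : ℕ) : ℝ) ^ σ := fun n => by
    exact div_le_div_of_nonneg_left (norm_nonneg _) (by positivity) (hpow n).le
  have hSτ := Summable.of_nonneg_of_le (fun n => by positivity) hmono hS
  refine ⟨hSτ, ?_⟩
  by_cases hz : ∀ n, a (n + 2) = 0
  · simpa [hz] using hd
  · push Not at hz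
    obtain ⟨n, hn⟩ := hz
    refine (hSτ.tsum_lt_tsum (i := n) hmono ?_ hS).trans_le hle'
    exact div_lt_div_of_pos_left (norm_pos_iff.2 hn) (by positivity) (hpow n)

theorem corollary2p2 (G : Set ℂ) (hGopen : IsOpen G) (hGne : G.Nonempty)
    (hGconv : Convex ℝ G) (hGbdd : Bornology.IsBounded G) :
    (bohrAdmissible (Metric.ball (0 : ℂ) 1)).Nonempty ∧ (bohrAdmissible G).Nonempty ∧
      isometricBohrAbscissa G = isometricBohrAbscissa (Metric.ball (0 : ℂ) 1) := by
  have hball : (bohrAdmissible (Metric.ball (0 : ℂ) 1)).Nonempty :=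
    ⟨6, six_mem_bohrAdmissible_ball⟩
  have hG : (bohrAdmissible G).Nonempty :=
    ⟨7, mem_bohrAdmissible_of_lt hGopen hGne hGconv hGbdd six_mem_bohrAdmissible_ball (by norm_num)⟩
  have hbdd : ∀ H : Set ℂ, BddBelow (bohrAdmissible H) := fun H => ⟨0, fun σ hσ => hσ.1⟩
  refine ⟨hball, hG, le_antisymm ?_ ?_⟩
  · refine le_csInf hball fun σ hσ => le_of_forall_gt_imp_ge_of_dense fun τ hτ => ?_
    exact csInf_le (hbdd G) (mem_bohrAdmissible_of_lt hGopen hGne hGconv hGbdd hσ hτ)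
  · exact csInf_le_csInf (hbdd _) hG
      (bohrAdmissible_subset_bohrAdmissible_ball hGopen hGne hGconv hGbdd)
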